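/- Let $\mathbb F$ be $\mathbb R$ or $\mathbb C$, let $1\le p\le n$, let $A\in\mathbb F^{n\times n}$ be Hermitian and invertible with smallest eigenvalue $\lambda_{\min}(A)$, and put $\omega_{\min}:=-\lambda_{\min}(A)$. Let $\mathcal T\subseteq\mathbb F^n$ be a $p$-dimensional affine subspace with associated linear subspace $\mathcal S:=\{x-y\mid x,y\in\mathcal T\}$. For $b\in\mathbb F^n$ and $\omega>\omega_{\min}$ let $$x_{b,\omega}:=\operatorname*{arg\,min}_{x\in\mathcal T}\ \bigl\|(A+\omega I)^{-1/2}(b-Ax)\bigr\|_2$$ (the minimizer exists and is unique). Let $\mathcal X_b$ be the affine hull of $\{x_{b,\omega}\mid \omega>\omega_{\min}\}$ and let $\mathcal X$ be the sum, over all $b\in\mathbb F^n$, of the linear subspaces associated with the $\mathcal X_b$; equivalently $$\mathcal X=\operatorname{span}\{x_{b,\omega}-x_{b,\mu}\mid b\in\mathbb F^n,\ \omega,\mu>\omega_{\min}\}.$$ Let $\mathbf{Ind}_A(\mathcal S):=\dim(\mathcal S+A\mathcal S)-\dim\mathcal S$ be the index of invariance of $\mathcal S$ with respect to $A$, and write $q:=\mathbf{Ind}_A(\mathcal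 S)$. Let $V\in\mathbb F^{n\times p}$ have orthonormal columns with $\operatorname{Im}V=\mathcal S$, let $V'\in\mathbb F^{n\times q}$ be such that $[\,V\ \ V'\,]$ has orthonormal columns and $\operatorname{Im}[\,V\ \ V'\,]=\mathcal S+A\mathcal S$, and put $T:=V^*AV\in\mathbb F^{p\times p}$, $B:=V'^*AV\in\mathbb F^{q\times p}$ (if $q=0$ then $V'$ and $B$ are empty and $\operatorname{Im}B^*=\{0\}$). Then $\dim\mathcal X=\mathbf{Ind}_A(\mathcal S)$ if any of the following conditions holds: (i) $\operatorname{Im}T\cap\operatorname{Im}B^*=\{0\}$; (ii) $T$ is invertible. -/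

import Mathlib

open scoped Matrix

namespace IndexInvariance

noncomputable section

variable {𝕜 : Type*} [RCLike 𝕜] {n : ℕ}

/-- The range `Im M ⊆ 𝕜^k` of a `k × l` matrix `M`, as a subspace of Euclidean space. -/
def img {k l : Type*} [Fintype k] [Fintype l] [DecidableEq l]
    (M : Matrix k l 𝕜) : Submodule 𝕜 (EuclideanSpace 𝕜 k) :=
  LinearMap.range (Matrix.toEuclideanLin M)

/-- A matrix is semi-unitary if its columns are orthonormal. -/
def SemiUnitary {k l : Type*} [Fintype k] [DecidableEq l]
    (M : Matrix k l 𝕜) : Prop :=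
  Mᴴ * M = 1

/-- The index of invariance `dim (S + A S) - dim S` of the subspace `S` with respect to `A`
(the natural subtraction never truncates, because `S ≤ S + A S`). -/
def ind (A : Matrix (Fin n) (Fin n) 𝕜) (S : Submodule 𝕜 (EuclideanSpace 𝕜 (Fin n))) : ℕ :=
  Module.finrank 𝕜 ↥(S ⊔ S.map (Matrix.toEuclideanLin A)) - Module.finrank 𝕜 ↥S

/-- `-λ_min(A)`, where `λ_min(A)` is the smallest (real) eigenvalue of the Hermitian matrix
`A`. -/
def omegaMin (A : Matrix (Fin n) (Fin n) 𝕜) : ℝ :=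
  -sInf (spectrum ℝ A)

/-- `A_ω = A + ω I`. -/
def shift (A : Matrix (Fin n) (Fin n) 𝕜) (ω : ℝ) : Matrix (Fin n) (Fin n) 𝕜 :=
  A + algebraMap ℝ (Matrix (Fin n) (Fin n) 𝕜) ω

/-- The real power `U Λ^s U*` of a positive matrix `U Λ U*` (`U` unitary, `Λ` diagonal), through
the functional calculus. -/
def matPow (M : Matrix (Fin n) (Fin n) 𝕜) (s : ℝ) : Matrix (Fin n) (Fin n) 𝕜 :=
  cfc (fun t : ℝ => t ^ s) M

/-- The objective `x ↦ ‖(A + ω I)^{-1/2} (b - A x)‖₂`. -/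
def objective (A : Matrix (Fin n) (Fin n) 𝕜) (b : EuclideanSpace 𝕜 (Fin n)) (ω : ℝ)
    (x : EuclideanSpace 𝕜 (Fin n)) : ℝ :=
  ‖Matrix.toEuclideanLin (matPow (shift A ω) (-1 / 2)) (b - Matrix.toEuclideanLin A x)‖

/-- `x` minimizes the objective over the affine subspace `𝒯`. -/
def IsArgmin (A : Matrix (Fin n) (Fin n) 𝕜) (𝒯 : AffineSubspace 𝕜 (EuclideanSpace 𝕜 (Fin n)))
    (b : EuclideanSpace 𝕜 (Fin n)) (ω : ℝ) (x : EuclideanSpace 𝕜 (Fin n)) : Prop :=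
  x ∈ 𝒯 ∧ ∀ y ∈ 𝒯, objective A b ω x ≤ objective A b ω y

/-- `x_{b,ω}`, the minimizer of the objective over `𝒯`; it exists and is unique whenever `A` is
Hermitian and invertible, `𝒯` is non-empty and `ω > -λ_min(A)`, see `existsUnique_isArgmin`. -/
def sol (A : Matrix (Fin n) (Fin n) 𝕜) (𝒯 : AffineSubspace 𝕜 (EuclideanSpace 𝕜 (Fin n)))
    (b : EuclideanSpace 𝕜 (Fin n)) (ω : ℝ) : EuclideanSpace 𝕜 (Fin n) :=
  Classical.epsilon (IsArgmin A 𝒯 b ω)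

/-- `𝒳_b`, the affine hull of the solutions `x_{b,ω}`, `ω > -λ_min(A)`. -/
def solHull (A : Matrix (Fin n) (Fin n) 𝕜) (𝒯 : AffineSubspace 𝕜 (EuclideanSpace 𝕜 (Fin n)))
    (b : EuclideanSpace 𝕜 (Fin n)) : AffineSubspace 𝕜 (EuclideanSpace 𝕜 (Fin n)) :=
  affineSpan 𝕜 {x | ∃ ω : ℝ, omegaMin A < ω ∧ x = sol A 𝒯 b ω}

/-- `𝒳`, the sum over all `b` of the linear subspaces parallel to `𝒳_b`. -/
def solSpace (A : Matrix (Fin n) (Fin n) 𝕜) (𝒯 : AffineSubspace 𝕜 (EuclideanSpace 𝕜 (Fin n))) :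
    Submodule 𝕜 (EuclideanSpace 𝕜 (Fin n)) :=
  ⨆ b : EuclideanSpace 𝕜 (Fin n), (solHull A 𝒯 b).direction

/-- `𝒳` is the span of all differences `x_{b,ω} - x_{b,μ}`. -/
theorem solSpace_eq_span (A : Matrix (Fin n) (Fin n) 𝕜)
    (𝒯 : AffineSubspace 𝕜 (EuclideanSpace 𝕜 (Fin n))) :
    solSpace A 𝒯 = Submodule.span 𝕜 {x | ∃ (b : EuclideanSpace 𝕜 (Fin n)) (ω μ : ℝ),
      omegaMin A < ω ∧ omegaMin A < μ ∧ x = sol A 𝒯 b ω - sol A 𝒯 b μ} := by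
  apply le_antisymm
  · refine iSup_le fun b => ?_
    rw [solHull, direction_affineSpan, vectorSpan_def, Submodule.span_le]
    rintro _ ⟨_, ⟨ω, hω, rfl⟩, _, ⟨μ, hμ, rfl⟩, rfl⟩
    exact Submodule.subset_span ⟨b, ω, μ, hω, hμ, rfl⟩
  · rw [Submodule.span_le]
    rintro _ ⟨b, ω, μ, hω, hμ, rfl⟩
    refine (le_iSup (fun b => (solHull A 𝒯 b).direction) b) ?_
    rw [solHull, direction_affineSpan]
    exact vsub_mem_vectorSpan 𝕜 ⟨ω, hω, rfl⟩ ⟨μ, hμ, rfl⟩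

theorem isUnit_matPow_shift {A : Matrix (Fin n) (Fin n) 𝕜} (hA : A.IsHermitian)
    {ω : ℝ} (hω : omegaMin A < ω) : IsUnit (matPow (shift A ω) (-1 / 2)) := by
  have hsa : IsSelfAdjoint (shift A ω) := by
    refine IsSelfAdjoint.add hA ?_
    exact IsSelfAdjoint.algebraMap _ (IsSelfAdjoint.all ω)
  have hfin : (spectrum ℝ A).Finite := by
    rw [hA.spectrum_real_eq_range_eigenvalues]
    exact Set.finite_range _
  have hfin' : (spectrum ℝ (shift A ω)).Finite := by
    rw [Matrix.IsHermitian.spectrum_real_eq_range_eigenvalues hsa]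
    exact Set.finite_range _
  rw [matPow, isUnit_cfc_iff _ _ (hfin'.continuousOn _) hsa]
  intro t ht
  have h1 : t - ω ∈ spectrum ℝ A := by
    have h2 := (spectrum.add_mem_add_iff (r := t - ω) (s := ω) (a := A)).1
    apply h2
    have : algebraMap ℝ (Matrix (Fin n) (Fin n) 𝕜) ω + A = shift A ω := add_comm _ _
    simpa [shift, add_comm] using ht
  have h3 := csInf_le hfin.bddBelow h1
  have h4 : 0 < t := by
    unfold omegaMin at hω
    linarith
  exact (Real.rpow_pos_of_pos h4 _).ne'

theorem injective_toEuclideanLin {M : Matrix (Fin n) (Fin n) 𝕜} (hM : IsUnit M) :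
    Function.Injective (Matrix.toEuclideanLin M) := by
  intro x y h
  have h' : M *ᵥ x.ofLp = M *ᵥ y.ofLp := by
    simpa using congrArg WithLp.ofLp h
  have := Matrix.mulVec_injective_of_isUnit hM h'
  exact WithLp.ofLp_injective _ this

/-- The minimization problem that defines `x_{b,ω}` has exactly one solution. -/
theorem existsUnique_isArgmin {A : Matrix (Fin n) (Fin n) 𝕜} (hA : A.IsHermitian)
    (hA' : IsUnit A) {𝒯 : AffineSubspace 𝕜 (EuclideanSpace 𝕜 (Fin n))}
    (h𝒯 : (𝒯 : Set (EuclideanSpace 𝕜 (Fin n))).Nonempty) (b : EuclideanSpace 𝕜 (Fin n))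
    {ω : ℝ} (hω : omegaMin A < ω) : ∃! x, IsArgmin A 𝒯 b ω x := by
  obtain ⟨t, ht⟩ := h𝒯
  set M := Matrix.toEuclideanLin (matPow (shift A ω) (-1 / 2)) with hM
  set L := M ∘ₗ Matrix.toEuclideanLin A with hL
  have hLinj : Function.Injective L :=
    (injective_toEuclideanLin (isUnit_matPow_shift hA hω)).comp (injective_toEuclideanLin hA')
  set K := 𝒯.direction.map L with hK
  obtain ⟨s, hs, hsK⟩ := Submodule.mem_map.1
    (K.starProjection_apply_mem (M (b - Matrix.toEuclideanLin A t)))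
  have horth : M (b - Matrix.toEuclideanLin A t) - L s ∈ Kᗮ := by
    rw [hsK]; exact K.sub_starProjection_mem_orthogonal _
  have key : ∀ y ∈ 𝒯, objective A b ω y * objective A b ω y =
      ‖M (b - Matrix.toEuclideanLin A t) - L s‖ * ‖M (b - Matrix.toEuclideanLin A t) - L s‖ +
        ‖L (y - t - s)‖ * ‖L (y - t - s)‖ := by
    intro y hy
    have hmem : L (y - t - s) ∈ K := Submodule.mem_map_of_mem
      (Submodule.sub_mem _ (AffineSubspace.vsub_mem_direction hy ht) hs)
    have h0 : inner 𝕜 (M (b - Matrix.toEuclideanLin A t) - L s) (L (y - t - s)) = 0 :=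
      Submodule.inner_left_of_mem_orthogonal hmem horth
    have h1 : M (b - Matrix.toEuclideanLin A y) =
        (M (b - Matrix.toEuclideanLin A t) - L s) - L (y - t - s) := by
      simp only [hL, LinearMap.comp_apply, map_sub]; abel
    have h2 : objective A b ω y = ‖(M (b - Matrix.toEuclideanLin A t) - L s)
        - L (y - t - s)‖ := by rw [← h1]; rfl
    rw [h2]
    have h3 := norm_sub_sq (𝕜 := 𝕜) (M (b - Matrix.toEuclideanLin A t) - L s) (L (y - t - s))
    rw [h0, map_zero] at h3
    linarith [h3]
  have hmem : s + t ∈ 𝒯 := AffineSubspace.vadd_mem_of_mem_direction hs ht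
  have hnn : ∀ y, 0 ≤ objective A b ω y := fun y => norm_nonneg _
  have hst : L (s + t - t - s) = 0 := by simp
  refine ⟨s + t, ⟨hmem, fun y hy => ?_⟩, fun y hy => ?_⟩
  · have e1 := key _ hmem
    have e2 := key _ hy
    rw [hst, norm_zero] at e1
    refine abs_le_of_sq_le_sq' ?_ (hnn y) |>.2
    nlinarith [mul_self_nonneg ‖L (y - t - s)‖]
  · have e1 := key _ hmem
    have e2 := key _ hy.1
    rw [hst, norm_zero] at e1
    have e3 := mul_self_le_mul_self (hnn y) (hy.2 _ hmem)
    have e4 : ‖L (y - t - s)‖ = 0 := by nlinarith [mul_self_nonneg ‖L (y - t - s)‖]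
    have e5 : y - t - s = 0 := hLinj (by simpa using e4)
    rw [sub_sub, sub_eq_zero] at e5
    rw [e5, add_comm]

/-- `x_{b,ω}` is the minimizer. -/
theorem isArgmin_sol {A : Matrix (Fin n) (Fin n) 𝕜} (hA : A.IsHermitian)
    (hA' : IsUnit A) {𝒯 : AffineSubspace 𝕜 (EuclideanSpace 𝕜 (Fin n))}
    (h𝒯 : (𝒯 : Set (EuclideanSpace 𝕜 (Fin n))).Nonempty) (b : EuclideanSpace 𝕜 (Fin n))
    {ω : ℝ} (hω : omegaMin A < ω) : IsArgmin A 𝒯 b ω (sol A 𝒯 b ω) :=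
  Classical.epsilon_spec (existsUnique_isArgmin hA hA' h𝒯 b hω).exists

end

end IndexInvariance

open IndexInvariance

namespace IndexInvariance

variable {𝕜 : Type*} [RCLike 𝕜] {n : ℕ}

local notation "𝔼" => EuclideanSpace 𝕜 (Fin n)

/-! Let `S` be the direction of `𝒯` and `P` the orthogonal projection onto `S`. The minimizer `x`
for `b, ω` satisfies `⟨A s, (A + ωI)⁻¹(b - A x)⟩ = 0` for all `s ∈ S`. If `g = A h` with `g, h ∈ S`,
then `A (g + ωh) = (A + ωI) g`, so the residual is orthogonal to `g` whatever `ω` is, and `P A g` is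
orthogonal to `𝒳`. Conversely, comparing two values of `ω` shows that every vector of `S` orthogonal
to `𝒳` has this form (`orthogonal_solSpace_inf_direction`).

Since `P A` is injective on `A S`, this gives `dim 𝒳 = dim S - dim (S ∩ A S)`. As `A` is invertible,
`dim A S = dim S`, and the right side equals `dim (S + A S) - dim S` (`finrank_solSpace`). -/

theorem isSelfAdjoint_shift {A : Matrix (Fin n) (Fin n) 𝕜} (hA : A.IsHermitian) (ω : ℝ) :
    IsSelfAdjoint (shift A ω) :=
  IsSelfAdjoint.add hA (IsSelfAdjoint.algebraMap _ (IsSelfAdjoint.all ω))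

theorem pos_of_mem_spectrum_shift {A : Matrix (Fin n) (Fin n) 𝕜} (hA : A.IsHermitian)
    {ω t : ℝ} (hω : omegaMin A < ω) (ht : t ∈ spectrum ℝ (shift A ω)) : 0 < t := by
  have hfin : (spectrum ℝ A).Finite := by
    rw [hA.spectrum_real_eq_range_eigenvalues]
    exact Set.finite_range _
  have h1 : t - ω ∈ spectrum ℝ A := by
    apply (spectrum.add_mem_add_iff (r := t - ω) (s := ω) (a := A)).1
    simpa [shift, add_comm] using ht
  have h3 := csInf_le hfin.bddBelow h1
  unfold omegaMin at hω
  linarith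

theorem isHermitian_matPow (M : Matrix (Fin n) (Fin n) 𝕜) (s : ℝ) : (matPow M s).IsHermitian :=
  cfc_predicate (R := ℝ) (p := IsSelfAdjoint) _ M

/-- The matrix `(A + ωI)^{-1/2}` is a square root of the inverse of `A + ωI`. -/
theorem matPow_shift_mul_mul {A : Matrix (Fin n) (Fin n) 𝕜} (hA : A.IsHermitian)
    {ω : ℝ} (hω : omegaMin A < ω) :
    matPow (shift A ω) (-1 / 2) * matPow (shift A ω) (-1 / 2) * shift A ω = 1 := by
  have hsa := isSelfAdjoint_shift hA ω
  have hfin : (spectrum ℝ (shift A ω)).Finite := by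
    rw [Matrix.IsHermitian.spectrum_real_eq_range_eigenvalues hsa]
    exact Set.finite_range _
  have hc : ∀ f : ℝ → ℝ, ContinuousOn f (spectrum ℝ (shift A ω)) := fun f => hfin.continuousOn f
  rw [matPow, ← cfc_mul _ _ _ (hc _) (hc _)]
  nth_rewrite 2 [← cfc_id ℝ (shift A ω) hsa]
  rw [← cfc_mul _ _ _ (hc _) (hc _), ← cfc_one ℝ (shift A ω) hsa]
  refine cfc_congr fun t ht => ?_
  have ht0 := pos_of_mem_spectrum_shift hA hω ht
  simp only [id, Pi.one_apply]
  rw [← Real.rpow_add ht0]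
  norm_num
  rw [Real.rpow_neg_one, inv_mul_cancel₀ ht0.ne']

theorem toEuclideanLin_mul_apply (M N : Matrix (Fin n) (Fin n) 𝕜) (x : 𝔼) :
    Matrix.toEuclideanLin (M * N) x = Matrix.toEuclideanLin M (Matrix.toEuclideanLin N x) := by
  apply WithLp.ofLp_injective
  simp

theorem toEuclideanLin_shift_apply (A : Matrix (Fin n) (Fin n) 𝕜) (ω : ℝ) (x : 𝔼) :
    Matrix.toEuclideanLin (shift A ω) x = Matrix.toEuclideanLin A x + (ω : 𝕜) • x := by
  have h : (algebraMap ℝ (Matrix (Fin n) (Fin n) 𝕜) ω) = (ω : 𝕜) • (1 : Matrix _ _ 𝕜) := by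
    rw [Algebra.algebraMap_eq_smul_one]
    ext i j
    simp [Matrix.smul_apply, RCLike.real_smul_eq_coe_mul]
  rw [shift, h, map_add, map_smul]
  apply WithLp.ofLp_injective
  simp

theorem inner_toEuclideanLin {M : Matrix (Fin n) (Fin n) 𝕜} (hM : M.IsHermitian) (x y : 𝔼) :
    inner 𝕜 (Matrix.toEuclideanLin M x) y = inner 𝕜 x (Matrix.toEuclideanLin M y) :=
  Matrix.isSymmetric_toEuclideanLin_iff.2 hM x y

/-- The inverse of `A + ωI`, as the square of `(A + ωI)^{-1/2}`. -/
noncomputable def shiftInv (A : Matrix (Fin n) (Fin n) 𝕜) (ω : ℝ) : 𝔼 →ₗ[𝕜] 𝔼 :=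
  Matrix.toEuclideanLin (matPow (shift A ω) (-1 / 2)) ∘ₗ
    Matrix.toEuclideanLin (matPow (shift A ω) (-1 / 2))

theorem inner_shiftInv (A : Matrix (Fin n) (Fin n) 𝕜) (ω : ℝ) (x y : 𝔼) :
    inner 𝕜 (shiftInv A ω x) y = inner 𝕜 x (shiftInv A ω y) := by
  simp only [shiftInv, LinearMap.comp_apply, inner_toEuclideanLin (isHermitian_matPow _ _)]

theorem shiftInv_apply_shift {A : Matrix (Fin n) (Fin n) 𝕜} (hA : A.IsHermitian)
    {ω : ℝ} (hω : omegaMin A < ω) (x : 𝔼) :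
    shiftInv A ω (Matrix.toEuclideanLin A x + (ω : 𝕜) • x) = x := by
  rw [← toEuclideanLin_shift_apply, shiftInv, LinearMap.comp_apply, ← toEuclideanLin_mul_apply,
    ← toEuclideanLin_mul_apply, matPow_shift_mul_mul hA hω]
  apply WithLp.ofLp_injective
  simp

theorem shift_apply_shiftInv {A : Matrix (Fin n) (Fin n) 𝕜} (hA : A.IsHermitian)
    {ω : ℝ} (hω : omegaMin A < ω) (x : 𝔼) :
    Matrix.toEuclideanLin A (shiftInv A ω x) + (ω : 𝕜) • shiftInv A ω x = x := by
  rw [← toEuclideanLin_shift_apply, shiftInv, LinearMap.comp_apply,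
    ← toEuclideanLin_mul_apply (matPow _ _), ← toEuclideanLin_mul_apply (shift A ω),
    mul_eq_one_comm.1 (matPow_shift_mul_mul hA hω)]
  apply WithLp.ofLp_injective
  simp

/-- Moving one square-root factor across turns the form into `‖(A + ωI)^{-1/2} x‖²`, and that factor
is injective. -/
theorem eq_zero_of_inner_shiftInv_self {A : Matrix (Fin n) (Fin n) 𝕜} (hA : A.IsHermitian)
    {ω : ℝ} (hω : omegaMin A < ω) {x : 𝔼} (hx : inner 𝕜 (shiftInv A ω x) x = 0) : x = 0 := by
  rw [shiftInv, LinearMap.comp_apply, inner_toEuclideanLin (isHermitian_matPow _ _),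
    inner_self_eq_zero] at hx
  exact injective_toEuclideanLin (isUnit_matPow_shift hA hω) (by rw [hx, map_zero])

/-- The normal equations of the minimization problem. -/
theorem IsArgmin.inner_eq_zero {A : Matrix (Fin n) (Fin n) 𝕜} {𝒯 : AffineSubspace 𝕜 𝔼}
    {b : 𝔼} {ω : ℝ} {x : 𝔼} (hx : IsArgmin A 𝒯 b ω x) {s : 𝔼} (hs : s ∈ 𝒯.direction) :
    inner 𝕜 (Matrix.toEuclideanLin A s) (shiftInv A ω (b - Matrix.toEuclideanLin A x)) = 0 := by
  set P := Matrix.toEuclideanLin (matPow (shift A ω) (-1 / 2)) with hP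
  set L := P ∘ₗ Matrix.toEuclideanLin A with hL
  set K := 𝒯.direction.map L
  -- Minimality over `𝒯` says that `0` is the point of `K` nearest to the weighted residual, which
  -- is therefore orthogonal to `K`.
  have hmin : ‖P (b - Matrix.toEuclideanLin A x) - 0‖ =
      ⨅ w : K, ‖P (b - Matrix.toEuclideanLin A x) - w‖ := by
    refine le_antisymm (le_ciInf ?_)
      (ciInf_le ⟨0, by rintro _ ⟨w, rfl⟩; exact norm_nonneg _⟩ (0 : K))
    rintro ⟨_, s', hs', rfl⟩
    have h := hx.2 (s' + x) (AffineSubspace.vadd_mem_of_mem_direction hs' hx.1)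
    have h' : b - Matrix.toEuclideanLin A (s' + x) =
        (b - Matrix.toEuclideanLin A x) - Matrix.toEuclideanLin A s' := by
      rw [map_add]; abel
    rw [objective, objective, h', ← hP, map_sub P (b - _)] at h
    simpa [hL] using h
  have h0 := (K.norm_eq_iInf_iff_inner_eq_zero K.zero_mem).1 hmin (L s)
    (Submodule.mem_map_of_mem hs)
  rw [sub_zero, inner_eq_zero_symm] at h0
  rw [shiftInv, LinearMap.comp_apply, ← inner_toEuclideanLin (isHermitian_matPow _ _)]
  exact h0

theorem sol_sub_sol_mem {A : Matrix (Fin n) (Fin n) 𝕜} (hA : A.IsHermitian) (hA' : IsUnit A)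
    {𝒯 : AffineSubspace 𝕜 𝔼} (h𝒯 : (𝒯 : Set 𝔼).Nonempty) (b : 𝔼)
    {ω μ : ℝ} (hω : omegaMin A < ω) (hμ : omegaMin A < μ) :
    sol A 𝒯 b ω - sol A 𝒯 b μ ∈ 𝒯.direction :=
  AffineSubspace.vsub_mem_direction (isArgmin_sol hA hA' h𝒯 b hω).1 (isArgmin_sol hA hA' h𝒯 b hμ).1

theorem solSpace_le_direction {A : Matrix (Fin n) (Fin n) 𝕜} (hA : A.IsHermitian) (hA' : IsUnit A)
    {𝒯 : AffineSubspace 𝕜 𝔼} (h𝒯 : (𝒯 : Set 𝔼).Nonempty) : solSpace A 𝒯 ≤ 𝒯.direction := by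
  rw [solSpace_eq_span, Submodule.span_le]
  rintro _ ⟨b, ω, μ, hω, hμ, rfl⟩
  exact sol_sub_sol_mem hA hA' h𝒯 b hω hμ

/-- The residual of the minimizer is orthogonal to every `g ∈ S` that lies in `A S`. -/
theorem inner_residual_eq_zero {A : Matrix (Fin n) (Fin n) 𝕜} (hA : A.IsHermitian)
    {𝒯 : AffineSubspace 𝕜 𝔼} {b : 𝔼} {ω : ℝ} (hω : omegaMin A < ω) {x : 𝔼}
    (hx : IsArgmin A 𝒯 b ω x) {g : 𝔼}
    (hg : g ∈ 𝒯.direction ⊓ 𝒯.direction.map (Matrix.toEuclideanLin A)) :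
    inner 𝕜 g (b - Matrix.toEuclideanLin A x) = 0 := by
  obtain ⟨hgS, h, hh, hhg⟩ := hg
  -- This test vector is chosen so that its image under `A` is `(A + ωI) g`, which cancels the
  -- inverse.
  have hs : g + (ω : 𝕜) • h ∈ 𝒯.direction :=
    Submodule.add_mem _ hgS (Submodule.smul_mem _ _ hh)
  have h0 := hx.inner_eq_zero hs
  rwa [map_add, map_smul, hhg, ← inner_shiftInv, shiftInv_apply_shift hA hω] at h0

theorem inner_starProjection_eq {S : Submodule 𝕜 𝔼} (v : 𝔼) {x : 𝔼} (hx : x ∈ S) :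
    inner 𝕜 (S.starProjection v) x = inner 𝕜 v x := by
  rw [Submodule.inner_starProjection_left_eq_right, Submodule.starProjection_eq_self_iff.2 hx]

/-- The quadratic form `s ↦ ⟨A s, (A + ωI)⁻¹ A s⟩` is nondegenerate on `S`. -/
theorem exists_starProjection_eq {A : Matrix (Fin n) (Fin n) 𝕜} (hA : A.IsHermitian)
    (hA' : IsUnit A) {ω : ℝ} (hω : omegaMin A < ω) {S : Submodule 𝕜 𝔼} {ξ : 𝔼} (hξ : ξ ∈ S) :
    ∃ η ∈ S, S.starProjection (Matrix.toEuclideanLin A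
      (shiftInv A ω (Matrix.toEuclideanLin A η))) = ξ := by
  set a := Matrix.toEuclideanLin A
  let H : S →ₗ[𝕜] S := (S.orthogonalProjectionOnto : 𝔼 →ₗ[𝕜] S) ∘ₗ a ∘ₗ shiftInv A ω ∘ₗ a ∘ₗ S.subtype
  have hH : ∀ s : S, (H s : 𝔼) = S.starProjection (a (shiftInv A ω (a s))) := fun s => rfl
  have hinj : Function.Injective H := by
    rw [← LinearMap.ker_eq_bot, LinearMap.ker_eq_bot']
    intro s hs
    -- Pairing `H s` with `s` yields the definite form at `A s`; in finite dimension, injectivity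
    -- then gives surjectivity.
    have h1 : inner 𝕜 (H s : 𝔼) (s : 𝔼) = 0 := by rw [hs]; simp
    rw [hH, inner_starProjection_eq _ s.2, inner_toEuclideanLin hA] at h1
    have h2 := eq_zero_of_inner_shiftInv_self hA hω h1
    exact Subtype.ext (injective_toEuclideanLin hA' (by rw [h2]; simp))
  obtain ⟨η, hη⟩ := LinearMap.injective_iff_surjective.1 hinj ⟨ξ, hξ⟩
  exact ⟨η, η.2, by rw [← hH, hη]⟩

/-- The orthogonal complement of `𝒳` within `S` is the compression of `A` to `S` applied to
`S ∩ A S`. -/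
theorem orthogonal_solSpace_inf_direction {A : Matrix (Fin n) (Fin n) 𝕜} (hA : A.IsHermitian)
    (hA' : IsUnit A) {𝒯 : AffineSubspace 𝕜 𝔼} (h𝒯 : (𝒯 : Set 𝔼).Nonempty) :
    (solSpace A 𝒯)ᗮ ⊓ 𝒯.direction =
      (𝒯.direction ⊓ 𝒯.direction.map (Matrix.toEuclideanLin A)).map
        ((𝒯.direction.starProjection : 𝔼 →ₗ[𝕜] 𝔼) ∘ₗ Matrix.toEuclideanLin A) := by
  set a := Matrix.toEuclideanLin A with ha
  set S := 𝒯.direction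
  apply le_antisymm
  · rintro ξ ⟨hξX, hξ⟩
    obtain ⟨ω, hω⟩ := exists_gt (omegaMin A)
    obtain ⟨μ, hμω⟩ := exists_gt ω
    have hμ := hω.trans hμω
    obtain ⟨η, hη, hηξ⟩ := exists_starProjection_eq hA hA' hω hξ
    obtain ⟨θ, hθ, hθξ⟩ := exists_starProjection_eq hA hA' hμ hξ
    obtain ⟨t, ht⟩ := h𝒯
    -- The normal equation tested with `ζ` removes the minimizer: the pairing with `ξ` becomes an
    -- explicit functional of `b`.
    have key : ∀ {ν : ℝ} (_ : omegaMin A < ν) {ζ : 𝔼} (_ : ζ ∈ S)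
        (_ : S.starProjection (a (shiftInv A ν (a ζ))) = ξ) (b : 𝔼),
        inner 𝕜 ξ (sol A 𝒯 b ν - t) = inner 𝕜 (shiftInv A ν (a ζ)) (b - a t) := by
      intro ν hν ζ hζ hζξ b
      have hx := isArgmin_sol hA hA' ⟨t, ht⟩ b hν
      have hxt : sol A 𝒯 b ν - t ∈ S := AffineSubspace.vsub_mem_direction hx.1 ht
      have h0 := hx.inner_eq_zero hζ
      rw [← inner_shiftInv, ← ha] at h0
      rw [← hζξ, inner_starProjection_eq _ hxt,
        inner_toEuclideanLin hA, ← ha, ← sub_zero (inner 𝕜 _ (b - a t)), ← h0, ← inner_sub_right,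
        map_sub]
      congr 1
      abel
    -- Since `ξ ⟂ 𝒳`, the functionals for `ω` and `μ` agree for all `b`, hence so do their
    -- representing vectors.
    have hg : shiftInv A ω (a η) = shiftInv A μ (a θ) := by
      refine ext_inner_right 𝕜 fun v => ?_
      have h1 := key hω hη hηξ (v + a t)
      have h2 := key hμ hθ hθξ (v + a t)
      rw [add_sub_cancel_right] at h1 h2
      rw [← h1, ← h2, ← sub_eq_zero, ← inner_sub_right, sub_sub_sub_cancel_right]
      refine Submodule.inner_left_of_mem_orthogonal ?_ hξX
      rw [solSpace_eq_span]
      exact Submodule.subset_span ⟨_, ω, μ, hω, hμ, rfl⟩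
    set g := shiftInv A ω (a η) with hgdef
    have e1 : a g + (ω : 𝕜) • g = a η := shift_apply_shiftInv hA hω _
    have e2 : a g + (μ : 𝕜) • g = a θ := by rw [hg]; exact shift_apply_shiftInv hA hμ _
    have hne : ((μ : 𝕜) - ω) ≠ 0 := by
      rw [sub_ne_zero]; exact_mod_cast hμω.ne'
    -- Subtracting `e1` from `e2` gives `(μ - ω) g = A (θ - η)`, so `g ∈ A S`; cancelling `A` in
    -- `e1` then gives `g ∈ S`.
    have e3 : g = a (((μ : 𝕜) - ω)⁻¹ • (θ - η)) := by
      rw [map_smul, map_sub, ← e1, ← e2, eq_inv_smul_iff₀ hne, sub_smul]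
      abel
    have e4 : g = η - (ω : 𝕜) • (((μ : 𝕜) - ω)⁻¹ • (θ - η)) := by
      apply injective_toEuclideanLin hA'
      rw [← ha, map_sub, map_smul, ← e3, ← e1, add_sub_cancel_right]
    have hs : ((μ : 𝕜) - ω)⁻¹ • (θ - η) ∈ S := S.smul_mem _ (S.sub_mem hθ hη)
    refine ⟨g, ⟨?_, _, hs, e3.symm⟩, hηξ⟩
    rw [e4]
    exact S.sub_mem hη (S.smul_mem _ hs)
  · rintro _ ⟨g, hg, rfl⟩
    refine ⟨?_, S.starProjection_apply_mem _⟩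
    rw [SetLike.mem_coe, solSpace_eq_span, Submodule.mem_orthogonal']
    intro u hu
    induction hu using Submodule.span_induction with
    | zero => exact inner_zero_right _
    | add x y _ _ hx hy => rw [inner_add_right, hx, hy, add_zero]
    | smul c x _ hx => rw [inner_smul_right, hx, mul_zero]
    | mem x hx =>
      obtain ⟨b, ω, μ, hω, hμ, rfl⟩ := hx
      have h1 := inner_residual_eq_zero hA hω (isArgmin_sol hA hA' h𝒯 b hω) hg
      have h2 := inner_residual_eq_zero hA hμ (isArgmin_sol hA hA' h𝒯 b hμ) hg
      change inner 𝕜 (S.starProjection (a g)) _ = 0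
      rw [inner_starProjection_eq _ (sol_sub_sol_mem hA hA' h𝒯 b hω hμ), inner_toEuclideanLin hA,
        ← sub_self (0 : 𝕜)]
      nth_rewrite 1 [← h2]
      rw [← h1, ← inner_sub_right, map_sub]
      congr 1
      abel

/-- The compression of `A` to `S` is injective on `S ∩ A S`. -/
theorem eq_zero_of_starProjection_eq_zero {A : Matrix (Fin n) (Fin n) 𝕜} (hA : A.IsHermitian)
    {S : Submodule 𝕜 𝔼} {g : 𝔼} (hg : g ∈ S.map (Matrix.toEuclideanLin A))
    (h0 : S.starProjection (Matrix.toEuclideanLin A g) = 0) : g = 0 := by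
  obtain ⟨h, hh, rfl⟩ := hg
  -- With `g = A h`, pairing the projection of `A g` with `h ∈ S` gives `‖A h‖²`.
  have h1 := inner_starProjection_eq (Matrix.toEuclideanLin A (Matrix.toEuclideanLin A h)) hh
  rwa [h0, inner_zero_left, inner_toEuclideanLin hA, eq_comm, inner_self_eq_zero] at h1

theorem finrank_map_eq_of_forall_eq_zero (f : 𝔼 →ₗ[𝕜] 𝔼) {W : Submodule 𝕜 𝔼}
    (hf : ∀ x ∈ W, f x = 0 → x = 0) : Module.finrank 𝕜 (W.map f) = Module.finrank 𝕜 W := by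
  rw [← LinearMap.range_domRestrict]
  refine LinearMap.finrank_range_of_inj ?_
  rw [← LinearMap.ker_eq_bot, LinearMap.ker_eq_bot']
  exact fun x hx => Subtype.ext (hf x x.2 hx)

/-- The dimension of `𝒳` is the index of invariance of `S`. -/
theorem finrank_solSpace {A : Matrix (Fin n) (Fin n) 𝕜} (hA : A.IsHermitian) (hA' : IsUnit A)
    {𝒯 : AffineSubspace 𝕜 𝔼} (h𝒯 : (𝒯 : Set 𝔼).Nonempty) :
    Module.finrank 𝕜 ↥(solSpace A 𝒯) = ind A 𝒯.direction := by
  set S := 𝒯.direction with hS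
  set W := S ⊓ S.map (Matrix.toEuclideanLin A) with hW
  have h1 := Submodule.finrank_add_inf_finrank_orthogonal (solSpace_le_direction hA hA' h𝒯)
  rw [orthogonal_solSpace_inf_direction hA hA' h𝒯, ← hS, ← hW] at h1
  have h2 := Submodule.finrank_sup_add_finrank_inf_eq S (S.map (Matrix.toEuclideanLin A))
  rw [finrank_map_eq_of_forall_eq_zero (Matrix.toEuclideanLin A) fun x _ hx =>
    injective_toEuclideanLin hA' (hx.trans (map_zero _).symm)] at h2
  set f : 𝔼 →ₗ[𝕜] 𝔼 := (S.starProjection : 𝔼 →ₗ[𝕜] 𝔼) ∘ₗ Matrix.toEuclideanLin A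
  have h3 : Module.finrank 𝕜 (W.map f) = Module.finrank 𝕜 W :=
    finrank_map_eq_of_forall_eq_zero f fun g hg hg0 =>
      eq_zero_of_starProjection_eq_zero hA hg.2 hg0
  rw [h3] at h1
  rw [← hW] at h2
  rw [ind]
  -- `h1` reads `dim 𝒳 + dim W = dim S` and `h2` reads `dim (S + A S) + dim W = 2 dim S`.
  omega

end IndexInvariance

theorem mainTheorem6 {𝕜 : Type*} [RCLike 𝕜] {n p : ℕ} (hp : 1 ≤ p)
    (A : Matrix (Fin n) (Fin n) 𝕜) (hA : A.IsHermitian) (hA' : IsUnit A)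
    (𝒯 : AffineSubspace 𝕜 (EuclideanSpace 𝕜 (Fin n)))
    (h𝒯 : (𝒯 : Set (EuclideanSpace 𝕜 (Fin n))).Nonempty)
    (V : Matrix (Fin n) (Fin p) 𝕜) (hV : SemiUnitary V) (hVS : img V = 𝒯.direction) :
    (∀ (q : ℕ) (V' : Matrix (Fin n) (Fin q) 𝕜),
        SemiUnitary (Matrix.fromCols V V') →
        img (Matrix.fromCols V V') =
          𝒯.direction ⊔ 𝒯.direction.map (Matrix.toEuclideanLin A) →
        img (Vᴴ * A * V) ⊓ img (V'ᴴ * A * V)ᴴ = ⊥ →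
        Module.finrank 𝕜 ↥(solSpace A 𝒯) = ind A 𝒯.direction) ∧
    (IsUnit (Vᴴ * A * V) →
        Module.finrank 𝕜 ↥(solSpace A 𝒯) = ind A 𝒯.direction) := by
  have h := finrank_solSpace hA hA' h𝒯
  exact ⟨fun _ _ _ _ _ => h, fun _ => h⟩
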